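/- For $n\ge 1$ let $\mathbf{\Sigma}^1_n,\mathbf{\Pi}^1_n,\mathbf{\Delta}^1_n$ be the boldface projective classes of subsets of Polish spaces: $\mathbf{\Sigma}^1_1$ sets are the analytic sets, $\mathbf{\Pi}^1_n$ sets are the complements of $\mathbf{\Sigma}^1_n$ sets, $\mathbf{\Sigma}^1_{n+1}$ subsets of $V$ are the projections to $V$ of $\mathbf{\Pi}^1_n$ subsets of $\omega^\omega\times V$, and $\mathbf{\Delta}^1_n=\mathbf{\Sigma}^1_n\cap\mathbf{\Pi}^1_n$. Each of these classes is called a Lusin pointclass. Let $\mathbf{P}$ be a Lusin pointclass, let $V$ be a Polish space, and let $f_0,f_1:V\to V$ be two $\mathbf{P}$ functions, i.e. $f_i^{-1}(U)\in\mathbf{P}$ for every open $U\subseteq V$. Let $G$ be the graph on $V$ generated by $f_0,f_1$: vertices $v,w$ are adjacent if and only if $v\ne w$ and there is $i\in\{0,1\}$ with $f_i(v)=w$ or $f_i(w)=v$. Let $\chi_{\mathbf{P}}(G)$ be the least cardinal $\kappa$ for which there is a proper colouring of $G$ with values in a set of cardinality $\kappa$ all of whose colour classes are in $\mathbf{P}$.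 Then either $\chi_{\mathbf{P}}(G)\le 5$, or $\chi_{\mathbf{P}}(G)$ is infinite. -/

import Mathlib

open Cardinal

universe u

/-- The class `Σ¹ₙ₊₁` of subsets of a space (so the index `0` stands for the analytic sets).
`Σ¹ₙ₊₂` consists of the projections of sets in `𝒩 × V` whose complement is `Σ¹ₙ₊₁`,
where `𝒩 = ℕ → ℕ` is the Baire space. -/
def IsProjSigma : (n : ℕ) → (V : Type u) → [TopologicalSpace V] → Set V → Prop
  | 0, _, _, A => MeasureTheory.AnalyticSet A
  | n + 1, V, _, A => ∃ B : Set ((ℕ → ℕ) × V), IsProjSigma n ((ℕ → ℕ) × V) Bᶜ ∧ A = Prod.snd '' B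

/-- The Lusin pointclasses: `sigma n`, `pi n`, `delta n` stand for the boldface classes
`Σ¹ₙ₊₁`, `Π¹ₙ₊₁`, `Δ¹ₙ₊₁` respectively, `n = 0, 1, 2, …`. -/
inductive LusinPointclass : Type
  | sigma (n : ℕ)
  | pi (n : ℕ)
  | delta (n : ℕ)

namespace LusinPointclass

/-- `P.Mem A`: the subset `A` of the space `V` belongs to the pointclass `P`. -/
def Mem (P : LusinPointclass) {V : Type u} [TopologicalSpace V] (A : Set V) : Prop :=
  match P with
  | sigma n => IsProjSigma n V A
  | pi n => IsProjSigma n V Aᶜ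
  | delta n => IsProjSigma n V A ∧ IsProjSigma n V Aᶜ

/-- A `P` function (a `P`-measurable function): preimages of open sets are in `P`. -/
def IsFunction (P : LusinPointclass) {V W : Type u} [TopologicalSpace V] [TopologicalSpace W]
    (f : V → W) : Prop :=
  ∀ U : Set W, IsOpen U → P.Mem (f ⁻¹' U)

/-- The cardinals `κ` for which `G` has a `P` class `κ`-colouring: a proper colouring with values
in a set of cardinality `κ`, every colour class of which is in `P`. -/
def colouringCardinals (P : LusinPointclass) {V : Type u} [TopologicalSpace V]
    (G : SimpleGraph V) : Set Cardinal.{u} :=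
  {κ | ∃ (A : Type u) (c : G.Coloring A), #A = κ ∧ ∀ a : A, P.Mem {v : V | c v = a}}

/-- The `P` class chromatic number of `G`: the least `κ` such that `G` has a `P` class
`κ`-colouring. -/
noncomputable def chromaticNumber (P : LusinPointclass) {V : Type u} [TopologicalSpace V]
    (G : SimpleGraph V) : Cardinal.{u} :=
  sInf (P.colouringCardinals G)

end LusinPointclass

/-- The graph generated by a family of functions from `V` to `V`. -/
def generatedGraph {ι : Type*} {V : Type u} (f : ι → V → V) : SimpleGraph V where
  Adj v w := v ≠ w ∧ ∃ i, f i v = w ∨ f i w = v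
  symm := ⟨fun _ _ h => ⟨h.1.symm, h.2.imp fun _ hi => hi.symm⟩⟩
  loopless := ⟨fun _ h => h.1 rfl⟩

/-- Borel sets lie in every `Σ¹ₙ₊₁`. -/
theorem IsProjSigma.of_borel (n : ℕ) : ∀ (V : Type u) [TopologicalSpace V] [PolishSpace V]
    (A : Set V), @MeasurableSet V (borel V) A → IsProjSigma n V A := by
  induction n with
  | zero =>
    intro V _ _ A hA
    borelize V
    exact hA.analyticSet
  | succ n ih =>
    intro V _ _ A hA
    refine ⟨Prod.snd ⁻¹' A, ih _ _ ?_, ?_⟩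
    · borelize V
      borelize ((ℕ → ℕ) × V)
      exact (continuous_snd.measurable hA).compl
    · exact (Set.image_preimage_eq A Prod.snd_surjective).symm

/-- The infimum that defines the chromatic number is over a nonempty set of cardinals
(hence attained): colour every vertex by itself. -/
theorem LusinPointclass.colouringCardinals_nonempty (P : LusinPointclass) {V : Type u}
    [TopologicalSpace V] [PolishSpace V] (G : SimpleGraph V) :
    (P.colouringCardinals G).Nonempty := by
  refine ⟨#V, V, G.selfColoring, rfl, fun a => ?_⟩
  borelize V
  have h : MeasurableSet {v : V | G.selfColoring v = a} := by
    have : {v : V | G.selfColoring v = a} = {a} := rfl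
    rw [this]; exact measurableSet_singleton a
  cases P with
  | sigma n => exact IsProjSigma.of_borel n V _ h
  | pi n => exact IsProjSigma.of_borel n V _ h.compl
  | delta n => exact ⟨IsProjSigma.of_borel n V _ h, IsProjSigma.of_borel n V _ h.compl⟩

/-! The classes of a finite `P`-colouring are ambiguous (`Σ¹ₙ₊₁` with `Σ¹ₙ₊₁` complement). Ambiguous
sets form a σ-algebra for which both maps are measurable, so recolouring takes place in a bare
measurable space (`exists_measurable_five_colouring`). A bounded colouring `c` makes recursion along
ascending, or along descending, edges terminate and stay measurable (`exists_measurable_rec`).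

In normal form (`exists_normal_colouring`), let Z be colour 0, let J be a kernel for descending
edges among the nonzero vertices without successor in Z, and let R be the rest. Edges between
distinct vertices outside R ascend into J, and a vertex of R has at most one successor in R. An
exceptional set `e` spreads backward from the vertices of Z with both successors in J, where colours
1 and 2 may not suffice. Outside R, vertices use 1, 2 off `e` and 2, 3, 4 on `e`; in R they use 3,
4, 5 off `e` and 1, 5 on `e`. The `colour_successor` lemmas check each kind of edge. -/

/-! ### Measurable recursion along two maps -/

section Recursion

variable {V : Type*} [MeasurableSpace V] {f : Bool → V → V}

/-- Recursion along the forward orbits of `f`, where a value may only depend on the values at those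
successors that have smaller rank, has a measurable solution. -/
theorem exists_measurable_rec {Q : Type*} [MeasurableSpace Q] [Nonempty Q]
    (hf : ∀ i, Measurable (f i)) {r : V → ℕ} (hr : Measurable r) (Φ : V → (Bool → Q) → Q)
    (hΦ : ∀ u : Bool → V → Q, (∀ i, Measurable (u i)) → Measurable fun x => Φ x fun i => u i x)
    (hdep : ∀ x q q', (∀ i, r (f i x) < r x → q i = q' i) → Φ x q = Φ x q') :
    ∃ φ : V → Q, Measurable φ ∧ ∀ x, φ x = Φ x fun i => φ (f i x) := by
  obtain ⟨q₀⟩ := ‹Nonempty Q›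
  let φ : ℕ → V → Q := fun n => n.rec (fun _ => q₀) fun _ ψ x => Φ x fun i => ψ (f i x)
  have hsucc : ∀ n x, φ (n + 1) x = Φ x fun i => φ n (f i x) := fun _ _ => rfl
  have hm : ∀ n, Measurable (φ n) := by
    intro n
    induction n with
    | zero => exact measurable_const
    | succ n ih => exact hΦ (fun i x => φ n (f i x)) fun i => ih.comp (hf i)
  have hstab : ∀ n m x, r x < n → r x < m → φ n x = φ m x := by
    intro n
    induction n with
    | zero => intro m x h; omega
    | succ n ih =>
      intro m x hn hm
      obtain ⟨m, rfl⟩ : ∃ k, m = k + 1 := ⟨m - 1, by omega⟩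
      rw [hsucc, hsucc]
      exact hdep _ _ _ fun i hi => ih _ _ (by omega) (by omega)
  -- By `hstab` the value at `x` is stable after more than `r x` stages, so the default `q₀` of
  -- stage 0 has no influence.
  refine ⟨fun x => φ (r x + 1) x, ?_, fun x => ?_⟩
  · have : Measurable fun p : ℕ × V => φ p.1 p.2 :=
      measurable_from_prod_countable_right fun n => hm n
    exact this.comp ((hr.add_const 1).prodMk measurable_id)
  · beta_reduce
    rw [hsucc]
    exact hdep _ _ _ fun i hi => hstab _ _ _ hi (Nat.lt_succ_self _)

/-- The least fixed point of a monotone disjunctive condition along `f` is measurable. -/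
theorem exists_measurable_fixpoint (hf : ∀ i, Measurable (f i)) {B : V → Prop}
    (hB : Measurable B) {S : Bool → V → Prop} (hS : ∀ i, Measurable (S i)) :
    ∃ e : V → Prop, Measurable e ∧ ∀ x, e x ↔ B x ∨ ∃ i, S i x ∧ e (f i x) := by
  let E : ℕ → V → Prop := fun n => n.rec (fun _ => False) fun _ ψ x => B x ∨ ∃ i, S i x ∧ ψ (f i x)
  have hsucc : ∀ n x, E (n + 1) x ↔ B x ∨ ∃ i, S i x ∧ E n (f i x) := fun _ _ => Iff.rfl
  have hm : ∀ n, Measurable (E n) := by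
    intro n
    induction n with
    | zero => exact measurable_const
    | succ n ih =>
      exact hB.or (Measurable.exists fun i => (hS i).and (ih.comp (hf i)))
  refine ⟨fun x => ∃ n, E n x, Measurable.exists hm, fun x => ⟨?_, ?_⟩⟩
  · rintro ⟨n, hn⟩
    cases n with
    | zero => exact hn.elim
    | succ n =>
      rcases (hsucc n x).1 hn with h | ⟨i, hi, h⟩
      exacts [Or.inl h, Or.inr ⟨i, hi, n, h⟩]
  · rintro (h | ⟨i, hi, n, h⟩)
    exacts [⟨1, Or.inl h⟩, ⟨n + 1, Or.inr ⟨i, hi, h⟩⟩]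

theorem Measurable.ite_prop {Q : Type*} [MeasurableSpace Q] {p : V → Prop}
    [∀ x, Decidable (p x)] {a b : V → Q} (hp : Measurable p) (ha : Measurable a)
    (hb : Measurable b) : Measurable fun x => if p x then a x else b x :=
  Measurable.ite (measurableSet_setOfPred.2 hp) ha hb

theorem Measurable.eq_const_nat {a : V → ℕ} (ha : Measurable a) (n : ℕ) :
    Measurable fun x => a x = n :=
  measurableSet_setOfPred.1 (measurableSet_eq_fun ha measurable_const)

end Recursion

/-! ### Reduction to nine colours in normal form -/

section NormalForm

open Classical in
/-- The least colour that is not used by those of the two successors that satisfy `P`. -/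
noncomputable def mexTwo (P : Bool → Prop) (q : Bool → ℕ) : ℕ :=
  if ∃ i, P i ∧ q i = 0 then if ∃ i, P i ∧ q i = 1 then 2 else 1 else 0

theorem mexTwo_le (P : Bool → Prop) (q : Bool → ℕ) : mexTwo P q ≤ 2 := by
  unfold mexTwo; split_ifs <;> omega

theorem mexTwo_ne {P : Bool → Prop} {q : Bool → ℕ} {i : Bool} (hi : P i) : mexTwo P q ≠ q i := by
  unfold mexTwo
  split_ifs with h0 h1
  · obtain ⟨j, hj, hj'⟩ := h0
    obtain ⟨k, hk, hk'⟩ := h1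
    cases i <;> cases j <;> cases k <;> omega
  · exact fun h => h1 ⟨i, hi, h.symm⟩
  · exact fun h => h0 ⟨i, hi, h.symm⟩

theorem exists_of_lt_mexTwo {P : Bool → Prop} {q : Bool → ℕ} (h : 0 < mexTwo P q) :
    ∃ i, P i ∧ q i < mexTwo P q := by
  unfold mexTwo at h ⊢
  split_ifs at h ⊢ with h0 h1
  · obtain ⟨i, hi, h⟩ := h0
    exact ⟨i, hi, by omega⟩
  · obtain ⟨i, hi, h⟩ := h0
    exact ⟨i, hi, by omega⟩
  · omega

theorem mexTwo_congr {P : Bool → Prop} {q q' : Bool → ℕ} (h : ∀ i, P i → q i = q' i) :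
    mexTwo P q = mexTwo P q' := by
  have (n : ℕ) : (∃ i, P i ∧ q i = n) ↔ ∃ i, P i ∧ q' i = n :=
    exists_congr fun i => and_congr_right fun hi => by rw [h i hi]
  have h0 := this 0
  have h1 := this 1
  unfold mexTwo
  split_ifs <;> first | rfl | exact absurd (h0.1 ‹_›) ‹_› | exact absurd (h0.2 ‹_›) ‹_› |
    exact absurd (h1.1 ‹_›) ‹_› | exact absurd (h1.2 ‹_›) ‹_›

theorem measurable_mexTwo {V : Type*} [MeasurableSpace V] {P : Bool → V → Prop}
    {q : Bool → V → ℕ} (hP : ∀ i, Measurable (P i)) (hq : ∀ i, Measurable (q i)) :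
    Measurable fun x => mexTwo (fun i => P i x) (fun i => q i x) := by
  have (n : ℕ) : Measurable fun x => ∃ i, P i x ∧ q i x = n :=
    Measurable.exists fun i => (hP i).and ((hq i).eq_const_nat n)
  classical
  exact (this 0).ite_prop ((this 1).ite_prop measurable_const measurable_const) measurable_const

/-- A bounded colouring can be replaced by one in which every vertex whose colour is not the least
one has a successor of smaller colour. -/
theorem exists_normal_colouring {V : Type*} [MeasurableSpace V] {f : Bool → V → V}
    (hf : ∀ i, Measurable (f i)) {N : ℕ} {c : V → ℕ} (hc : Measurable c) (hN : ∀ x, c x < N)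
    (hp : ∀ i x, f i x ≠ x → c (f i x) ≠ c x) :
    ∃ c' : V → ℕ, Measurable c' ∧ (∀ x, c' x < 9) ∧ (∀ i x, f i x ≠ x → c' (f i x) ≠ c' x) ∧
      ∀ x, c' x ≠ 0 → ∃ i, c' (f i x) < c' x := by
  -- `q` separates the ends of ascending edges; `p` separates those of descending edges on which `q`
  -- is constant. In `3 * q + p` a nonzero mex yields a successor of smaller value.
  obtain ⟨q, hqm, hq⟩ := exists_measurable_rec hf (r := fun x => N - c x) (by fun_prop)
    (fun x q => mexTwo (fun i => c x < c (f i x)) q)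
    (fun u hu => measurable_mexTwo (by fun_prop) hu)
    (fun x q q' h => mexTwo_congr fun i hi => h i (by have := hN x; have := hN (f i x); omega))
  obtain ⟨p, hpm, hpr⟩ := exists_measurable_rec hf hc
    (fun x p => mexTwo (fun i => c (f i x) < c x ∧ q (f i x) = q x) p)
    (fun u hu => measurable_mexTwo (fun i => by
      refine Measurable.and (by fun_prop) ?_
      exact measurableSet_setOfPred.1 (measurableSet_eq_fun (hqm.comp (hf i)) hqm)) hu)
    (fun x q q' h => mexTwo_congr fun i hi => h i hi.1)
  have hq2 : ∀ x, q x ≤ 2 := fun x => by rw [hq]; exact mexTwo_le _ _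
  have hp2 : ∀ x, p x ≤ 2 := fun x => by rw [hpr]; exact mexTwo_le _ _
  refine ⟨fun x => 3 * q x + p x, by fun_prop, fun x => ?_, fun i x hi => ?_, fun x hx => ?_⟩ <;> beta_reduce at *
  · have := hq2 x; have := hp2 x; omega
  · have h1 := hp2 x; have h2 := hp2 (f i x)
    rcases lt_or_gt_of_ne (hp i x hi) with h | h
    · by_cases he : q (f i x) = q x
      · have : p x ≠ p (f i x) := by
          rw [hpr x]; exact mexTwo_ne (P := fun i => c (f i x) < c x ∧ q (f i x) = q x) ⟨h, he⟩
        omega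
      · omega
    · have : q x ≠ q (f i x) := by
        rw [hq x]; exact mexTwo_ne (P := fun i => c x < c (f i x)) h
      omega
  · by_cases h0 : p x = 0
    · have : 0 < q x := by omega
      rw [hq] at this
      obtain ⟨i, -, hi⟩ := exists_of_lt_mexTwo this
      rw [← hq] at hi
      have := hp2 (f i x)
      exact ⟨i, by omega⟩
    · have : 0 < p x := by omega
      rw [hpr] at this
      obtain ⟨i, hi, hi'⟩ := exists_of_lt_mexTwo this
      rw [← hpr] at hi'
      have := hi.2
      exact ⟨i, by omega⟩

end NormalForm

/-! ### The five-colouring -/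

/-- The combinatorial data from which the five-colouring is built. The successors of a vertex `x` are
`f false x` and `f true x`, and `c` is a proper colouring by natural numbers in which every vertex of
nonzero colour has a successor of smaller colour. -/
structure ColouringData {V : Type*} (f : Bool → V → V) where
  (c : V → ℕ)
  (J R e T : V → Prop)
  (q σ ω τ : V → ℕ)
  c_ne : ∀ i x, f i x ≠ x → c (f i x) ≠ c x
  exists_lt : ∀ x, c x ≠ 0 → ∃ i, c (f i x) < c x
  R_iff : ∀ x, R x ↔ c x ≠ 0 ∧ ¬ J x
  J_iff : ∀ x, J x ↔ c x ≠ 0 ∧ (∀ i, c (f i x) ≠ 0) ∧ ∀ i, c (f i x) < c x → ¬ J (f i x)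
  -- The clause from Z into R ascends while the one from J descends, so no recursion ranked by `c`
  -- applies; any fixed point suffices.
  e_iff : ∀ x, e x ↔ (c x = 0 ∧ ∀ i, J (f i x)) ∨
    ∃ i, ((c x = 0 ∧ J (f (!i) x) ∧ R (f i x)) ∨
      (R x ∧ ¬ R (f i x) ∧ R (f (!i) x) ∧ c (f (!i) x) < c x) ∨
      (J x ∧ c (f i x) < c x ∧ R (f i x) ∧ J (f (!i) x))) ∧ e (f i x)
  -- On `e` within R the R-successor is lower; `T` receives colour 1 and the rest of `e` in R colour
  -- 5.
  T_iff : ∀ x, T x ↔ R x ∧ e x ∧ ∀ i, c (f i x) < c x → ¬ T (f i x)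
  q_eq : open Classical in ∀ x, q x =
    if e x then
      if ∃ i, (c x < c (f i x) ∧ ¬ R (f i x)) ∧ q (f i x) = 2 then if c x = 0 then 3 else 4 else 2
    else if ∃ i, T (f i x) ∨ (c x < c (f i x) ∧ ¬ R (f i x)) ∧ q (f i x) = 1 then 2 else 1
  -- Values 6 and 7 are placeholders, resolved by `ω` and `τ`: `σ` recurses along descending edges,
  -- `ω` and `τ` along ascending ones.
  σ_eq : open Classical in ∀ x, σ x =
    if T x then 1 else if e x then 5 else
    if ∃ i, (c x < c (f i x) ∧ R (f i x)) ∧ ¬ R (f (!i) x) ∧ e (f (!i) x) then 6 else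
    if ∃ i, c x < c (f i x) ∧ R (f i x) then 7 else
    if ∃ i, (c (f i x) < c x ∧ R (f i x)) ∧ σ (f i x) = 6 then 7 else
    if ∃ i, (c (f i x) < c x ∧ R (f i x)) ∧ σ (f i x) = 5 then 3 else 5
  -- Relevant when the successor outside R is in `e`, so has colour 2, 3 or 4. Colour 5 is
  -- preferred; if the R-successor has it, one of 3, 4 is free.
  ω_eq : open Classical in ∀ x, ω x =
    if ∃ i, (c x < c (f i x) ∧ R (f i x)) ∧
        (σ (f i x) = 5 ∨ σ (f i x) = 6 ∧ ω (f i x) = 5) then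
      if ∃ i, ¬ R (f i x) ∧ q (f i x) = 3 then 4 else 3
    else 5
  -- Relevant when the successor outside R has colour 1 or 2, so only the R-successor matters. The
  -- disjunct with `ω` also serves descending edges, `ω` being already known.
  τ_eq : open Classical in ∀ x, τ x =
    if ∃ i, R (f i x) ∧ (c x < c (f i x) ∧ σ (f i x) = 3 ∨ σ (f i x) = 6 ∧ ω (f i x) = 3 ∨
        (c x < c (f i x) ∧ σ (f i x) = 7) ∧ τ (f i x) = 3) then 4 else 3

namespace ColouringData

variable {V : Type*} {f : Bool → V → V} (S : ColouringData f) {x : V} {i j : Bool}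

open Classical in
/-- The five-colouring, with colours `1, …, 5`. -/
noncomputable def colour (x : V) : ℕ :=
  if S.R x then if S.σ x = 6 then S.ω x else if S.σ x = 7 then S.τ x else S.σ x else S.q x

theorem eq_not (h : i ≠ j) : i = !j := by cases i <;> cases j <;> simp_all

theorem lt_or_lt (h : f i x ≠ x) : S.c (f i x) < S.c x ∨ S.c x < S.c (f i x) :=
  lt_or_gt_of_ne (S.c_ne i x h)

theorem not_J_of_R (h : S.R x) : ¬ S.J x := ((S.R_iff x).1 h).2

theorem not_R_of_J (h : S.J x) : ¬ S.R x := fun h' => S.not_J_of_R h' h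

theorem R_of_T (h : S.T x) : S.R x := ((S.T_iff x).1 h).1

theorem e_of_T (h : S.T x) : S.e x := ((S.T_iff x).1 h).2.1

theorem J_of_not_R (h : ¬ S.R x) (hx : S.c x ≠ 0) : S.J x := by
  by_contra h'
  exact h ((S.R_iff x).2 ⟨hx, h'⟩)

/-- Failing the condition for J at nonzero colour means a successor in Z or a lower one in J. Hence
at most one of the two successors is in R. -/
theorem exists_not_R (h : S.R x) : ∃ i, S.c (f i x) < S.c x ∧ ¬ S.R (f i x) := by
  obtain ⟨hx, hJ⟩ := (S.R_iff x).1 h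
  rw [S.J_iff] at hJ
  by_cases h0 : ∀ i, S.c (f i x) ≠ 0
  · have : ∃ i, S.c (f i x) < S.c x ∧ S.J (f i x) := by
      by_contra hcon
      push Not at hcon
      exact hJ ⟨hx, h0, hcon⟩
    obtain ⟨i, hi, hi'⟩ := this
    exact ⟨i, hi, S.not_R_of_J hi'⟩
  · push Not at h0
    obtain ⟨i, hi⟩ := h0
    exact ⟨i, by omega, fun hR => ((S.R_iff _).1 hR).1 hi⟩

/-- The normal form gives a lower successor, which the condition for J keeps out of both Z and J. -/
theorem exists_R (h : S.J x) : ∃ i, S.c (f i x) < S.c x ∧ S.R (f i x) := by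
  obtain ⟨hx, h0, hJ⟩ := (S.J_iff x).1 h
  obtain ⟨i, hi⟩ := S.exists_lt x hx
  exact ⟨i, hi, (S.R_iff _).2 ⟨h0 i, hJ i hi⟩⟩

/-- A successor outside `R` of a vertex outside `R` is in `J` and has larger colour. -/
theorem lt_and_J (hx : ¬ S.R x) (hy : ¬ S.R (f i x)) (hi : f i x ≠ x) :
    S.c x < S.c (f i x) ∧ S.J (f i x) := by
  by_cases h0 : S.c x = 0
  · have := S.c_ne i x hi
    exact ⟨by omega, S.J_of_not_R hy (by omega)⟩
  · have hJ := (S.J_iff x).1 (S.J_of_not_R hx h0)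
    have hy' := S.J_of_not_R hy (hJ.2.1 i)
    refine ⟨(S.lt_or_lt hi).resolve_left fun h => hJ.2.2 i h hy', hy'⟩

theorem q_of_e (h : S.e x) : S.q x = 2 ∨ S.c x = 0 ∧ S.q x = 3 ∨ S.c x ≠ 0 ∧ S.q x = 4 := by
  rw [S.q_eq, if_pos h]
  split_ifs with h1 h2
  exacts [.inr (.inl ⟨h2, rfl⟩), .inr (.inr ⟨h2, rfl⟩), .inl rfl]

theorem q_of_not_e (h : ¬ S.e x) : S.q x = 1 ∨ S.q x = 2 := by
  rw [S.q_eq, if_neg h]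
  split_ifs
  exacts [.inr rfl, .inl rfl]

/-- Each clause for `e` outside R puts in J every successor except the one carrying `e`. -/
theorem e_successor (hx : ¬ S.R x) (he : S.e x) (hy : S.R (f i x)) : S.e (f i x) := by
  rcases (S.e_iff x).1 he with ⟨-, h⟩ | ⟨j, h | h | h, hj⟩
  · exact absurd (h i) (S.not_J_of_R hy)
  · by_cases hij : i = j
    · rwa [hij]
    · rw [eq_not hij] at hy
      exact absurd h.2.1 (S.not_J_of_R hy)
  · exact absurd h.1 hx
  · by_cases hij : i = j
    · rwa [hij]
    · rw [eq_not hij] at hy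
      exact absurd h.2.2.2 (S.not_J_of_R hy)

/-- Off `e`, colours 1 and 2 suffice: beside an ascending successor in J, a successor in `T`, or at
colour 0 a second one in J, would put `x` in `e`. -/
theorem q_ne_q (hx : ¬ S.R x) (hy : ¬ S.R (f i x)) (hi : f i x ≠ x) : S.q (f i x) ≠ S.q x := by
  obtain ⟨hA, hJ⟩ := S.lt_and_J hx hy hi
  -- no vertex of `J` has two successors outside `R` of larger colour
  have key : S.c x ≠ 0 → ∀ j, S.c x < S.c (f j x) → ¬ S.R (f j x) → j = i := by
    intro h0 j hj hj'
    by_contra hji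
    obtain ⟨k, hk, hk'⟩ := S.exists_R (S.J_of_not_R hx h0)
    by_cases hki : k = i
    · subst hki; omega
    · rw [eq_not hki, ← eq_not hji] at hk; omega
  by_cases he : S.e x
  · by_cases h2 : ∃ j, (S.c x < S.c (f j x) ∧ ¬ S.R (f j x)) ∧ S.q (f j x) = 2
    · rw [S.q_eq x, if_pos he, if_pos h2]
      have hy0 := ((S.J_iff _).1 hJ).1
      -- At colour 0 the successor is in J, where 3 never occurs. In J, `key` leaves one ascending
      -- successor outside R, and it has 2, not 4.
      split_ifs with h0
      · by_cases hey : S.e (f i x)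
        · have := S.q_of_e hey; omega
        · have := S.q_of_not_e hey; omega
      · obtain ⟨j, hj, hj'⟩ := h2
        rw [key h0 j hj.1 hj.2] at hj'
        omega
    · rw [S.q_eq x, if_pos he, if_neg h2]
      exact fun h => h2 ⟨i, ⟨hA, hy⟩, h⟩
  · by_cases h1 : ∃ j, S.T (f j x) ∨ (S.c x < S.c (f j x) ∧ ¬ S.R (f j x)) ∧ S.q (f j x) = 1
    · rw [S.q_eq x, if_neg he, if_pos h1]
      obtain ⟨j, hj | hj⟩ := h1
      · exfalso
        have hji : j ≠ i := by rintro rfl; exact hy (S.R_of_T hj)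
        have hij : i = !j := eq_not hji.symm
        subst hij
        refine he ((S.e_iff x).2 (.inr ⟨j, ?_, S.e_of_T hj⟩))
        by_cases h0 : S.c x = 0
        · exact .inl ⟨h0, hJ, S.R_of_T hj⟩
        · have hJx := S.J_of_not_R hx h0
          obtain ⟨k, hk, hk'⟩ := S.exists_R hJx
          have : k = j := by
            by_contra hkj
            rw [eq_not hkj] at hk
            omega
          subst this
          exact .inr (.inr ⟨hJx, hk, hk', hJ⟩)
      · by_cases hji : j = i
        · subst hji; omega
        · exfalso
          by_cases h0 : S.c x = 0
          · refine he ((S.e_iff x).2 (.inl ⟨h0, fun k => ?_⟩))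
            by_cases hk : k = i
            · rwa [hk]
            · rw [eq_not hk, ← eq_not hji]
              exact S.J_of_not_R hj.1.2 (by omega)
          · exact hji (key h0 j hj.1.1 hj.1.2)
    · rw [S.q_eq x, if_neg he, if_neg h1]
      exact fun h => h1 ⟨i, .inr ⟨⟨hA, hy⟩, h⟩⟩

theorem σ_of_T (h : S.T x) : S.σ x = 1 := by rw [S.σ_eq, if_pos h]

theorem σ_of_e (h : S.e x) (h' : ¬ S.T x) : S.σ x = 5 := by rw [S.σ_eq, if_neg h', if_pos h]

theorem σ_ne_one (h : ¬ S.T x) : S.σ x ≠ 1 := by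
  rw [S.σ_eq, if_neg h]
  split_ifs <;> omega

theorem σ_mem (x : V) : S.σ x = 1 ∨ S.σ x = 3 ∨ S.σ x = 5 ∨ S.σ x = 6 ∨ S.σ x = 7 := by
  rw [S.σ_eq]
  split_ifs <;> omega

theorem ω_mem (x : V) : S.ω x = 3 ∨ S.ω x = 4 ∨ S.ω x = 5 := by
  rw [S.ω_eq]
  split_ifs <;> omega

theorem τ_mem (x : V) : S.τ x = 3 ∨ S.τ x = 4 := by
  rw [S.τ_eq]
  split_ifs <;> omega

theorem q_mem (x : V) : 1 ≤ S.q x ∧ S.q x ≤ 4 := by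
  rw [S.q_eq]
  split_ifs <;> omega

theorem colour_mem (x : V) : 1 ≤ S.colour x ∧ S.colour x ≤ 5 := by
  have := S.σ_mem x
  have := S.ω_mem x
  have := S.τ_mem x
  have := S.q_mem x
  unfold colour
  split_ifs <;> omega

theorem colour_eq_q (h : ¬ S.R x) : S.colour x = S.q x := if_neg h

theorem colour_of_R (h : S.R x) :
    S.σ x = 6 ∧ S.colour x = S.ω x ∨ S.σ x = 7 ∧ S.colour x = S.τ x ∨
      (S.σ x = 1 ∨ S.σ x = 3 ∨ S.σ x = 5) ∧ S.colour x = S.σ x := by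
  have := S.σ_mem x
  unfold colour
  rw [if_pos h]
  split_ifs <;> omega

/-- On `e`, an R-successor has 1 or 5 and `x` has 2, 3 or 4. Off `e`, `x` has 1 or 2, and it has 2
if a successor is in `T`. -/
theorem colour_successor_of_not_R (hx : ¬ S.R x) (hi : f i x ≠ x) :
    S.colour (f i x) ≠ S.colour x := by
  rw [S.colour_eq_q hx]
  by_cases hy : S.R (f i x)
  · have hc := S.colour_of_R hy
    have hω := S.ω_mem (f i x)
    have hτ := S.τ_mem (f i x)
    have hq := S.q_mem x
    by_cases he : S.e x
    · have hey := S.e_successor hx he hy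
      have hqe := S.q_of_e he
      by_cases hT : S.T (f i x)
      · have := S.σ_of_T hT; omega
      · have := S.σ_of_e hey hT; omega
    · have hqe := S.q_of_not_e he
      by_cases hT : S.T (f i x)
      · have := S.σ_of_T hT
        have : S.q x = 2 := by rw [S.q_eq, if_neg he, if_pos ⟨i, .inl hT⟩]
        omega
      · have := S.σ_ne_one hT; omega
  · rw [S.colour_eq_q hy]
    exact S.q_ne_q hx hy hi

/-- If `x` is in `T`, the successor outside R inherits `e` and so avoids colour 1. -/
theorem colour_successor_of_R_of_not_R (hx : S.R x) (hy : ¬ S.R (f i x)) :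
    S.colour (f i x) ≠ S.colour x := by
  rw [S.colour_eq_q hy]
  have hR : ∀ j, S.R (f j x) → j = !i := fun j hj => eq_not (by rintro rfl; exact hy hj)
  have hc := S.colour_of_R hx
  have hω := S.ω_mem x
  have hτ := S.τ_mem x
  have hq := S.q_mem (f i x)
  by_cases he : S.e x
  · by_cases hT : S.T x
    · have hey : S.e (f i x) := by
        rcases (S.e_iff x).1 he with ⟨h, -⟩ | ⟨j, h | h | h, hj⟩
        · exact absurd h ((S.R_iff x).1 hx).1
        · exact absurd h.1 ((S.R_iff x).1 hx).1
        · have := hR _ h.2.2.1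
          rw [Bool.not_eq_eq_eq_not, Bool.not_not] at this
          rwa [← this]
        · exact absurd h.1 (S.not_J_of_R hx)
      have := S.σ_of_T hT
      have := S.q_of_e hey
      omega
    · have := S.σ_of_e he hT; omega
  · have hT : ¬ S.T x := fun h => he (S.e_of_T h)
    have hσ := S.σ_eq x
    rw [if_neg hT, if_neg he] at hσ
    split_ifs at hσ with h1 h2 h3 h4
    · obtain ⟨j, hj, -, hej⟩ := h1
      rw [hR j hj.2, Bool.not_not] at hej
      have hqe := S.q_of_e hej
      have hω := S.ω_eq x
      split_ifs at hω with h5 h6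
      · obtain ⟨k, hk, hk'⟩ := h6
        have : S.q (f i x) = 3 := by
          by_cases hki : k = i
          · rwa [← hki]
          · rw [eq_not hki, ← hR j hj.2] at hk
            exact absurd hj.2 hk
        omega
      · have : S.q (f i x) ≠ 3 := fun h => h6 ⟨i, hy, h⟩
        omega
      · omega
    · obtain ⟨j, hj, hj'⟩ := h2
      have : ¬ S.e (f i x) := by
        intro h
        have := hR j hj'
        subst this
        exact h1 ⟨!i, ⟨hj, hj'⟩, by rw [Bool.not_not]; exact ⟨hy, h⟩⟩
      have := S.q_of_not_e this
      omega
    all_goals try omega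
    -- Were the successor outside R in `e`, the descending R-successor would put `x` in `e`; so its
    -- colour is 1 or 2.
    all_goals
      obtain ⟨j, hj, -⟩ := ‹∃ i, (S.c (f i x) < S.c x ∧ S.R (f i x)) ∧ _›
      have : ¬ S.e (f i x) := by
        intro h
        have hji := hR j hj.2
        subst hji
        exact he ((S.e_iff x).2 (.inr ⟨i, .inr (.inl ⟨hx, hy, hj.2, hj.1⟩), h⟩))
      have := S.q_of_not_e this
      omega

/-- As `f i x` is the only R-successor, every existential in `σ`, `ω`, `τ` about R-successors speaks
of it alone. -/
theorem colour_successor_of_R_of_R (hx : S.R x) (hy : S.R (f i x)) (hi : f i x ≠ x) :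
    S.colour (f i x) ≠ S.colour x := by
  obtain ⟨k, hkD, hkR⟩ := S.exists_not_R hx
  have hR : ∀ j, S.R (f j x) → j = i := by
    have hik : i = !k := eq_not (by rintro rfl; exact hkR hy)
    intro j hj
    rw [hik]
    exact eq_not (by rintro rfl; exact hkR hj)
  have hi' := S.lt_or_lt hi
  have hc := S.colour_of_R hx
  have hcy := S.colour_of_R hy
  have hω := S.ω_mem x
  have hτ := S.τ_mem x
  have hωy := S.ω_mem (f i x)
  have hτy := S.τ_mem (f i x)
  by_cases he : S.e x
  · have hD : S.c (f i x) < S.c x := by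
      rcases (S.e_iff x).1 he with ⟨h, -⟩ | ⟨j, h | h | h, hj⟩
      · exact absurd h ((S.R_iff x).1 hx).1
      · exact absurd h.1 ((S.R_iff x).1 hx).1
      · rw [← hR _ h.2.2.1]; exact h.2.2.2
      · exact absurd h.1 (S.not_J_of_R hx)
    by_cases hT : S.T x
    · have hTy := ((S.T_iff x).1 hT).2.2 i hD
      have := S.σ_of_T hT
      have := S.σ_ne_one hTy
      omega
    · have : S.T (f i x) := by
        by_contra hTy
        refine hT ((S.T_iff x).2 ⟨hx, he, fun j hj hTj => ?_⟩)
        rw [hR j (S.R_of_T hTj)] at hTj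
        exact hTy hTj
      have := S.σ_of_T this
      have := S.σ_of_e he hT
      omega
  · have hT : ¬ S.T x := fun h => he (S.e_of_T h)
    have hσ := S.σ_eq x
    rw [if_neg hT, if_neg he] at hσ
    have hτ_eq := S.τ_eq x
    have hτ_iff : (∃ i, S.R (f i x) ∧ (S.c x < S.c (f i x) ∧ S.σ (f i x) = 3 ∨
        S.σ (f i x) = 6 ∧ S.ω (f i x) = 3 ∨
        (S.c x < S.c (f i x) ∧ S.σ (f i x) = 7) ∧ S.τ (f i x) = 3)) ↔
        (S.c x < S.c (f i x) ∧ S.σ (f i x) = 3 ∨ S.σ (f i x) = 6 ∧ S.ω (f i x) = 3 ∨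
        (S.c x < S.c (f i x) ∧ S.σ (f i x) = 7) ∧ S.τ (f i x) = 3) :=
      ⟨fun ⟨j, hj, h⟩ => by rwa [hR j hj] at h, fun h => ⟨i, hy, h⟩⟩
    split_ifs at hσ with h1 h2 h3 h4
    · clear hτ_eq hτ_iff
      obtain ⟨j, hj, -⟩ := h1
      have hji := hR j hj.2
      subst hji
      have hω_eq := S.ω_eq x
      by_cases h5 : S.σ (f j x) = 5 ∨ S.σ (f j x) = 6 ∧ S.ω (f j x) = 5
      · rw [if_pos ⟨j, hj, h5⟩] at hω_eq
        split_ifs at hω_eq <;> omega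
      · rw [if_neg] at hω_eq
        · omega
        · rintro ⟨l, hl, h6⟩
          rw [hR l hl.2] at h6
          exact h5 h6
    · obtain ⟨j, hj, hj'⟩ := h2
      have hji := hR j hj'
      subst hji
      split_ifs at hτ_eq with h5
      · have := hτ_iff.1 h5; omega
      · have := mt hτ_iff.2 h5
        omega
    · obtain ⟨j, hj, hj'⟩ := h3
      have hji := hR j hj.2
      subst hji
      split_ifs at hτ_eq with h5
      · have := hτ_iff.1 h5; omega
      · have := mt hτ_iff.2 h5
        omega
    · obtain ⟨j, hj, hj'⟩ := h4
      have hji := hR j hj.2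
      subst hji
      omega
    · have hD : S.c (f i x) < S.c x := hi'.resolve_right fun h => h2 ⟨i, h, hy⟩
      have h5 : S.σ (f i x) ≠ 6 := fun h => h3 ⟨i, ⟨hD, hy⟩, h⟩
      have h6 : S.σ (f i x) ≠ 5 := fun h => h4 ⟨i, ⟨hD, hy⟩, h⟩
      omega

theorem colour_ne (i : Bool) (x : V) (hi : f i x ≠ x) : S.colour (f i x) ≠ S.colour x := by
  by_cases hx : S.R x
  · by_cases hy : S.R (f i x)
    · exact S.colour_successor_of_R_of_R hx hy hi
    · exact S.colour_successor_of_R_of_not_R hx hy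
  · exact S.colour_successor_of_not_R hx hi

end ColouringData

/-! ### Measurability of the five-colouring -/

open Classical in
/-- Two measurable maps with a measurable proper colouring by a bounded set of natural numbers have
a measurable proper five-colouring. -/
theorem exists_measurable_five_colouring {V : Type*} [MeasurableSpace V] {f : Bool → V → V}
    (hf : ∀ i, Measurable (f i)) {N : ℕ} {c : V → ℕ} (hc : Measurable c) (hN : ∀ x, c x < N)
    (hp : ∀ i x, f i x ≠ x → c (f i x) ≠ c x) :
    ∃ d : V → ℕ, Measurable d ∧ (∀ x, d x < 5) ∧ ∀ i x, f i x ≠ x → d (f i x) ≠ d x := by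
  obtain ⟨c, hc, hN, hp, hnf⟩ := exists_normal_colouring hf hc hN hp
  -- The rank for recursion along ascending edges, strict because `c` is below 9.
  have hr : Measurable fun x => 9 - c x := by fun_prop
  have hrank : ∀ {x i}, c x < c (f i x) → 9 - c (f i x) < 9 - c x := fun {x i} h => by
    have := hN (f i x); omega
  have hc0 : Measurable fun x => c x = 0 := hc.eq_const_nat 0
  obtain ⟨J, hJm, hJ⟩ := exists_measurable_rec hf hc
    (fun x J => c x ≠ 0 ∧ (∀ i, c (f i x) ≠ 0) ∧ ∀ i, c (f i x) < c x → ¬ J i)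
    (fun u hu => hc0.not.and <| (Measurable.forall fun i => (hc0.comp (hf i)).not).and (by fun_prop))
    (fun x q q' h => by
      have : (∀ i, c (f i x) < c x → ¬ q i) ↔ ∀ i, c (f i x) < c x → ¬ q' i :=
        forall_congr' fun i => imp_congr_right fun hi => by rw [h i hi]
      simp only [this])
  have hR : Measurable fun x => c x ≠ 0 ∧ ¬ J x := hc0.not.and hJm.not
  generalize hRdef : (fun x => c x ≠ 0 ∧ ¬ J x) = R at hR
  obtain ⟨e, hem, he⟩ := exists_measurable_fixpoint hf
    (B := fun x => c x = 0 ∧ ∀ i, J (f i x)) (hc0.and (by fun_prop))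
    (S := fun i x => (c x = 0 ∧ J (f (!i) x) ∧ R (f i x)) ∨
      (R x ∧ ¬ R (f i x) ∧ R (f (!i) x) ∧ c (f (!i) x) < c x) ∨
      (J x ∧ c (f i x) < c x ∧ R (f i x) ∧ J (f (!i) x)))
    (fun i => (hc0.and (by fun_prop)).or (by fun_prop))
  obtain ⟨T, hTm, hT⟩ := exists_measurable_rec hf hc
    (fun x T => R x ∧ e x ∧ ∀ i, c (f i x) < c x → ¬ T i)
    (fun u hu => by fun_prop)
    (fun x q q' h => by
      have : (∀ i, c (f i x) < c x → ¬ q i) ↔ ∀ i, c (f i x) < c x → ¬ q' i :=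
        forall_congr' fun i => imp_congr_right fun hi => by rw [h i hi]
      simp only [this])
  have hup : ∀ {x : V} {q q' : Bool → ℕ}, (∀ i, 9 - c (f i x) < 9 - c x → q i = q' i) →
      ∀ i, c x < c (f i x) → q i = q' i := fun h i hi => h i (hrank hi)
  obtain ⟨q, hqm, hq⟩ := exists_measurable_rec hf hr
    (fun x q => if e x then
        if ∃ i, (c x < c (f i x) ∧ ¬ R (f i x)) ∧ q i = 2 then if c x = 0 then 3 else 4 else 2
      else if ∃ i, T (f i x) ∨ (c x < c (f i x) ∧ ¬ R (f i x)) ∧ q i = 1 then 2 else 1)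
    (fun u hu => hem.ite_prop
      ((Measurable.exists fun i => (by fun_prop : Measurable fun x => c x < c (f i x) ∧ ¬ R (f i x)).and
        ((hu i).eq_const_nat 2)).ite_prop
        (hc0.ite_prop measurable_const measurable_const) measurable_const)
      ((Measurable.exists fun i => (hTm.comp (hf i)).or
        ((by fun_prop : Measurable fun x => c x < c (f i x) ∧ ¬ R (f i x)).and
        ((hu i).eq_const_nat 1))).ite_prop measurable_const measurable_const))
    (fun x q q' h => by
      have (n : ℕ) (i : Bool) : ((c x < c (f i x) ∧ ¬ R (f i x)) ∧ q i = n) ↔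
          (c x < c (f i x) ∧ ¬ R (f i x)) ∧ q' i = n :=
        and_congr_right fun hi => by rw [hup h i hi.1]
      simp only [this])
  obtain ⟨σ, hσm, hσ⟩ := exists_measurable_rec hf hc
    (fun x σ => if T x then 1 else if e x then 5 else
      if ∃ i, (c x < c (f i x) ∧ R (f i x)) ∧ ¬ R (f (!i) x) ∧ e (f (!i) x) then 6 else
      if ∃ i, c x < c (f i x) ∧ R (f i x) then 7 else
      if ∃ i, (c (f i x) < c x ∧ R (f i x)) ∧ σ i = 6 then 7 else
      if ∃ i, (c (f i x) < c x ∧ R (f i x)) ∧ σ i = 5 then 3 else 5)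
    (fun u hu => by
      have (n : ℕ) : Measurable fun x => ∃ i, (c (f i x) < c x ∧ R (f i x)) ∧ u i x = n :=
        Measurable.exists fun i => (by fun_prop : Measurable fun x => c (f i x) < c x ∧ R (f i x)).and
          ((hu i).eq_const_nat n)
      exact hTm.ite_prop measurable_const <| hem.ite_prop measurable_const <|
        Measurable.ite_prop (by fun_prop) measurable_const <|
        Measurable.ite_prop (by fun_prop) measurable_const <|
        (this 6).ite_prop measurable_const <| (this 5).ite_prop measurable_const measurable_const)
    (fun x q q' h => by
      have (n : ℕ) (i : Bool) : ((c (f i x) < c x ∧ R (f i x)) ∧ q i = n) ↔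
          (c (f i x) < c x ∧ R (f i x)) ∧ q' i = n :=
        and_congr_right fun hi => by rw [h i hi.1]
      simp only [this])
  have hσn (n : ℕ) (i : Bool) : Measurable fun x => σ (f i x) = n := (hσm.comp (hf i)).eq_const_nat n
  have hqn (n : ℕ) (i : Bool) : Measurable fun x => q (f i x) = n := (hqm.comp (hf i)).eq_const_nat n
  have hup' (x : V) (i : Bool) : Measurable fun x => c x < c (f i x) ∧ R (f i x) := by fun_prop
  obtain ⟨ω, hωm, hω⟩ := exists_measurable_rec hf hr
    (fun x ω => if ∃ i, (c x < c (f i x) ∧ R (f i x)) ∧ (σ (f i x) = 5 ∨ σ (f i x) = 6 ∧ ω i = 5)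
      then if ∃ i, ¬ R (f i x) ∧ q (f i x) = 3 then 4 else 3 else 5)
    (fun u hu => (Measurable.exists fun i =>
        (by fun_prop : Measurable fun x => c x < c (f i x) ∧ R (f i x)).and
        ((hσn 5 i).or ((hσn 6 i).and ((hu i).eq_const_nat 5)))).ite_prop
      ((Measurable.exists fun i => (hR.comp (hf i)).not.and (hqn 3 i)).ite_prop
        measurable_const measurable_const) measurable_const)
    (fun x q q' h => by
      have (i : Bool) : ((c x < c (f i x) ∧ R (f i x)) ∧
          (σ (f i x) = 5 ∨ σ (f i x) = 6 ∧ q i = 5)) ↔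
          (c x < c (f i x) ∧ R (f i x)) ∧ (σ (f i x) = 5 ∨ σ (f i x) = 6 ∧ q' i = 5) :=
        and_congr_right fun hi => by rw [hup h i hi.1]
      simp only [this])
  obtain ⟨τ, hτm, hτ⟩ := exists_measurable_rec hf hr
    (fun x τ => if ∃ i, R (f i x) ∧ (c x < c (f i x) ∧ σ (f i x) = 3 ∨
        σ (f i x) = 6 ∧ ω (f i x) = 3 ∨
        (c x < c (f i x) ∧ σ (f i x) = 7) ∧ τ i = 3) then 4 else 3)
    (fun u hu => (Measurable.exists fun i => by
        have h1 : Measurable fun x => c x < c (f i x) := by fun_prop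
        exact (hR.comp (hf i)).and ((h1.and (hσn 3 i)).or
          (((hσn 6 i).and ((hωm.comp (hf i)).eq_const_nat 3)).or
          ((h1.and (hσn 7 i)).and ((hu i).eq_const_nat 3))))).ite_prop
        measurable_const measurable_const)
    (fun x q q' h => by
      have (i : Bool) : ((c x < c (f i x) ∧ σ (f i x) = 7) ∧ q i = 3) ↔
          (c x < c (f i x) ∧ σ (f i x) = 7) ∧ q' i = 3 :=
        and_congr_right fun hi => by rw [hup h i hi.1]
      simp only [this])
  let S : ColouringData f :=
    { c := c, J := J, R := R, e := e, T := T, q := q, σ := σ, ω := ω, τ := τ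
      c_ne := hp
      exists_lt := hnf
      R_iff := fun x => by rw [← hRdef]
      J_iff := fun x => iff_of_eq (hJ x)
      e_iff := he
      T_iff := fun x => iff_of_eq (hT x)
      q_eq := hq
      σ_eq := hσ
      ω_eq := hω
      τ_eq := hτ }
  have hS : Measurable S.colour :=
    hR.ite_prop ((hσm.eq_const_nat 6).ite_prop hωm ((hσm.eq_const_nat 7).ite_prop hτm hσm)) hqm
  refine ⟨fun x => S.colour x - 1, by fun_prop, fun x => ?_, fun i x hi => ?_⟩ <;> beta_reduce
  · have := S.colour_mem x; omega
  · have := S.colour_mem x; have := S.colour_mem (f i x); have := S.colour_ne i x hi; omega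

/-! ### Closure properties of the projective classes -/

namespace IsProjSigma

open Set MeasureTheory

variable {V W : Type u} [TopologicalSpace V] [PolishSpace V] [TopologicalSpace W] [PolishSpace W]

theorem mem_snd_image {α β : Type*} {B : Set (α × β)} {y : β} :
    y ∈ Prod.snd '' B ↔ ∃ x, (x, y) ∈ B := by
  simp

theorem preimage {n : ℕ} : ∀ {V W : Type u} [TopologicalSpace V] [PolishSpace V]
    [TopologicalSpace W] [PolishSpace W] {A : Set W} {f : V → W},
    IsProjSigma n W A → Continuous f → IsProjSigma n V (f ⁻¹' A) := by
  induction n with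
  | zero =>
    intro V W _ _ _ _ A f hA hf
    exact AnalyticSet.preimage hA hf
  | succ n ih =>
    rintro V W _ _ _ _ A f ⟨B, hB, rfl⟩ hf
    refine ⟨Prod.map id f ⁻¹' B, ?_, ?_⟩
    · rw [← preimage_compl]
      exact ih hB (continuous_id.prodMap hf)
    · ext v
      simp only [mem_preimage, mem_snd_image, Prod.map_apply, id]

/-- A witness for a union is an index followed by a witness; one for an intersection codes a
sequence of witnesses by `Nat.pair`. In both cases the complement of the projected set is a
countable union one level down. For unions its terms are intersections, hence the joint induction.
-/
theorem iUnion_and_iInter (n : ℕ) : ∀ {V : Type u} [TopologicalSpace V] [PolishSpace V]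
    {s : ℕ → Set V}, (∀ k, IsProjSigma n V (s k)) →
      IsProjSigma n V (⋃ k, s k) ∧ IsProjSigma n V (⋂ k, s k) := by
  induction n with
  | zero =>
    intro V _ _ s hs
    exact ⟨AnalyticSet.iUnion hs, AnalyticSet.iInter hs⟩
  | succ n ih =>
    intro V _ _ s hs
    choose B hB hs using hs
    have hunion : ∀ {V : Type u} [TopologicalSpace V] [PolishSpace V] {s t : Set V},
        IsProjSigma n V s → IsProjSigma n V t → IsProjSigma n V (s ∩ t) := by
      intro V _ _ s t hs ht
      have h := (ih (s := fun k => if k = 0 then s else t) fun k => by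
        split_ifs <;> assumption).2
      convert h using 1
      ext v
      simp only [mem_inter_iff, mem_iInter]
      refine ⟨fun h k => ?_, fun h => ⟨h 0, h 1⟩⟩
      split_ifs
      exacts [h.1, h.2]
    constructor
    · refine ⟨{p | ((fun i => p.1 (i + 1), p.2) : (ℕ → ℕ) × V) ∈ B (p.1 0)}, ?_, ?_⟩
      · have h : ∀ k, IsProjSigma n ((ℕ → ℕ) × V) ({p | p.1 0 = k} ∩
            (fun p : (ℕ → ℕ) × V => ((fun i => p.1 (i + 1), p.2) : (ℕ → ℕ) × V)) ⁻¹' (B k)ᶜ) := by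
          intro k
          refine hunion (of_borel n _ _ ?_) (preimage (hB k) (by fun_prop))
          borelize ((ℕ → ℕ) × V)
          exact (isClosed_eq (by fun_prop) continuous_const).measurableSet
        convert (ih h).1 using 1
        ext p
        simp
      · ext v
        simp only [mem_iUnion, hs, mem_snd_image, mem_ofPred_eq]
        constructor
        · rintro ⟨k, x, hx⟩
          exact ⟨fun i => i.casesOn k x, hx⟩
        · rintro ⟨x, hx⟩
          exact ⟨_, _, hx⟩
    · refine ⟨{p | ∀ k, ((fun i => p.1 (Nat.pair k i), p.2) : (ℕ → ℕ) × V) ∈ B k}, ?_, ?_⟩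
      · have h : ∀ k, IsProjSigma n ((ℕ → ℕ) × V) ((fun p : (ℕ → ℕ) × V =>
            ((fun i => p.1 (Nat.pair k i), p.2) : (ℕ → ℕ) × V)) ⁻¹' (B k)ᶜ) :=
          fun k => preimage (hB k) (by fun_prop)
        convert (ih h).1 using 1
        ext p
        simp
      · ext v
        simp only [mem_iInter, hs, mem_snd_image, mem_ofPred_eq]
        constructor
        · intro h
          choose x hx using h
          exact ⟨fun m => x m.unpair.1 m.unpair.2, fun k => by simpa using hx k⟩
        · rintro ⟨x, hx⟩ k
          exact ⟨_, hx k⟩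

theorem iUnion {n : ℕ} {ι : Type*} [Countable ι] {s : ι → Set V}
    (hs : ∀ k, IsProjSigma n V (s k)) : IsProjSigma n V (⋃ k, s k) := by
  cases isEmpty_or_nonempty ι
  · rw [iUnion_of_empty]
    exact of_borel n V _ (@MeasurableSet.empty V (borel V))
  · obtain ⟨e, he⟩ := exists_surjective_nat ι
    rw [← he.iUnion_comp]
    exact (iUnion_and_iInter n fun k => hs (e k)).1

theorem iInter {n : ℕ} {ι : Type*} [Countable ι] {s : ι → Set V}
    (hs : ∀ k, IsProjSigma n V (s k)) : IsProjSigma n V (⋂ k, s k) := by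
  cases isEmpty_or_nonempty ι
  · rw [iInter_of_empty]
    exact of_borel n V _ (@MeasurableSet.univ V (borel V))
  · obtain ⟨e, he⟩ := exists_surjective_nat ι
    rw [← he.iInter_comp]
    exact (iUnion_and_iInter n fun k => hs (e k)).2

theorem union {n : ℕ} {s t : Set V} (hs : IsProjSigma n V s) (ht : IsProjSigma n V t) :
    IsProjSigma n V (s ∪ t) := by
  rw [union_eq_iUnion]
  exact iUnion (Bool.rec ht hs)

theorem inter {n : ℕ} {s t : Set V} (hs : IsProjSigma n V s) (ht : IsProjSigma n V t) :
    IsProjSigma n V (s ∩ t) := by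
  rw [inter_eq_iInter]
  exact iInter (Bool.rec ht hs)

/-- Even and odd coordinates merge two projections along Baire space into one. -/
theorem snd_image : ∀ {n : ℕ} {B : Set ((ℕ → ℕ) × V)}, IsProjSigma n ((ℕ → ℕ) × V) B →
    IsProjSigma n V (Prod.snd '' B)
  | 0, _, hB => AnalyticSet.image_of_continuous hB continuous_snd
  | n + 1, _, ⟨C, hC, rfl⟩ => by
    refine ⟨(fun p : (ℕ → ℕ) × V => ((fun i => p.1 (2 * i),
      (fun i => p.1 (2 * i + 1), p.2)) : (ℕ → ℕ) × (ℕ → ℕ) × V)) ⁻¹' C, ?_, ?_⟩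
    · rw [← preimage_compl]
      exact preimage hC (by fun_prop)
    · ext v
      simp only [mem_snd_image, mem_preimage]
      constructor
      · rintro ⟨x, y, h⟩
        refine ⟨fun m => if m % 2 = 0 then y (m / 2) else x (m / 2), ?_⟩
        have h1 : ∀ i, (2 * i + 1) / 2 = i := fun i => by omega
        simpa [Nat.add_mod, h1] using h
      · rintro ⟨x, h⟩
        exact ⟨_, _, h⟩

theorem exists_mem [Nonempty W] {n : ℕ} {E : Set (W × V)} (hE : IsProjSigma n (W × V) E) :
    IsProjSigma n V {v | ∃ w, (w, v) ∈ E} := by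
  obtain ⟨π, hπ, hsurj⟩ := PolishSpace.exists_nat_nat_continuous_surjective W
  convert snd_image (preimage hE (hπ.prodMap (continuous_id (X := V)))) using 1
  ext v
  simp only [mem_snd_image, mem_preimage, Prod.map_apply, id, mem_ofPred_eq]
  exact hsurj.exists

variable (V) in
/-- The σ-algebra of the sets that are `Σ¹ₙ₊₁` together with their complement. -/
@[reducible] def ambiguous (n : ℕ) : MeasurableSpace V where
  MeasurableSet' A := IsProjSigma n V A ∧ IsProjSigma n V Aᶜ
  measurableSet_empty := ⟨of_borel n V _ (@MeasurableSet.empty V (borel V)), by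
    rw [compl_empty]
    exact of_borel n V _ (@MeasurableSet.univ V (borel V))⟩
  measurableSet_compl _ hA := ⟨hA.2, by rw [compl_compl]; exact hA.1⟩
  measurableSet_iUnion s hs := ⟨iUnion fun k => (hs k).1, by
    rw [compl_iUnion]
    exact iInter fun k => (hs k).2⟩

/-- If the preimages of open sets under `f` are ambiguous, then the graph of `f` is a countable
intersection of `Σ¹ₙ₊₁` sets, and so the preimages of `Σ¹ₙ₊₁` sets are `Σ¹ₙ₊₁`. -/
theorem preimage_of_isOpen {n : ℕ} {f : V → W} {A : Set W} (hA : IsProjSigma n W A)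
    (hf : ∀ U : Set W, IsOpen U → MeasurableSet[ambiguous V n] (f ⁻¹' U)) :
    IsProjSigma n V (f ⁻¹' A) := by
  cases isEmpty_or_nonempty W
  · have : f ⁻¹' A = ∅ := by
      ext v
      exact isEmptyElim (f v)
    rw [this]
    exact of_borel n V _ (@MeasurableSet.empty V (borel V))
  let b := TopologicalSpace.countableBasis W
  have hb := TopologicalSpace.isBasis_countableBasis W
  have : Countable b := (TopologicalSpace.countable_countableBasis W).to_subtype
  have hopen : ∀ U : b, IsOpen (U : Set W) := fun U => hb.isOpen U.2
  -- The graph of `f`, coordinates swapped: `w` and `f v` lie in the same basic open sets.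
  have hG : IsProjSigma n (W × V) (⋂ U : b, (Prod.fst ⁻¹' (U : Set W) ∩ Prod.snd ⁻¹' (f ⁻¹' U)) ∪
      (Prod.fst ⁻¹' (U : Set W)ᶜ ∩ Prod.snd ⁻¹' (f ⁻¹' U)ᶜ)) := by
    borelize W
    refine iInter fun U => union (inter ?_ ?_) (inter ?_ ?_)
    · exact preimage (of_borel n W _ (hopen U).measurableSet) continuous_fst
    · exact preimage (hf U (hopen U)).1 continuous_snd
    · exact preimage (of_borel n W _ (hopen U).measurableSet.compl) continuous_fst
    · exact preimage (hf U (hopen U)).2 continuous_snd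
  convert exists_mem ((preimage hA continuous_fst).inter hG) using 1
  ext v
  simp only [mem_preimage, mem_inter_iff, mem_iInter, mem_union, mem_compl_iff, mem_ofPred_eq]
  constructor
  · exact fun h => ⟨f v, h, fun U => by tauto⟩
  · rintro ⟨w, hw, h⟩
    suffices w = f v by rwa [← this]
    refine hb.eq_iff.2 fun U hU => ?_
    have := h ⟨U, hU⟩
    tauto

/-- Ambiguous sets on both sides, rather than Borel sets in the target, allow composition and so
recursion along orbits. -/
theorem measurable_ambiguous {n : ℕ} {f : V → W}
    (hf : ∀ U : Set W, IsOpen U → MeasurableSet[ambiguous V n] (f ⁻¹' U)) :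
    Measurable[ambiguous V n, ambiguous W n] f :=
  fun _ hA => ⟨preimage_of_isOpen hA.1 hf, preimage_of_isOpen hA.2 hf⟩

end IsProjSigma

/-! ### From a Lusin class to its ambiguous σ-algebra -/

namespace LusinPointclass

open Set MeasureTheory

variable {V W : Type u} [TopologicalSpace V] [PolishSpace V] [TopologicalSpace W] [PolishSpace W]

/-- The number `n` for which the pointclass is one of `Σ¹ₙ₊₁`, `Π¹ₙ₊₁`, `Δ¹ₙ₊₁`. -/
def level : LusinPointclass → ℕ
  | sigma n => n
  | pi n => n
  | delta n => n

theorem Mem.of_ambiguous {P : LusinPointclass} {A : Set V}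
    (hA : MeasurableSet[IsProjSigma.ambiguous V P.level] A) : P.Mem A := by
  cases P
  exacts [hA.1, hA.2, hA]

/-- A closed set is a countable intersection of open sets, so preimages of closed sets stay in the
class; this gives the missing half. -/
theorem IsFunction.ambiguous_preimage {P : LusinPointclass} {f : V → W} (hf : P.IsFunction f)
    {U : Set W} (hU : IsOpen U) : MeasurableSet[IsProjSigma.ambiguous V P.level] (f ⁻¹' U) := by
  let := TopologicalSpace.upgradeIsCompletelyMetrizable W
  cases P with
  | sigma n =>
    refine ⟨hf U hU, ?_⟩
    obtain ⟨G, hG, h⟩ := isGδ_iff_eq_iInter_nat.1 hU.isClosed_compl.isGδ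
    rw [← preimage_compl, h, preimage_iInter]
    exact IsProjSigma.iInter fun k => hf _ (hG k)
  | pi n =>
    refine ⟨?_, hf U hU⟩
    obtain ⟨G, hG, h⟩ := isGδ_iff_eq_iInter_nat.1 hU.isClosed_compl.isGδ
    rw [← compl_compl U, h, compl_iInter, preimage_iUnion]
    exact IsProjSigma.iUnion fun k => hf _ (hG k)
  | delta n => exact hf U hU

/-- The complement of a class is the countable union of the others. -/
theorem ambiguous_fiber {P : LusinPointclass} {A : Type*} [Countable A] {c : V → A}
    (hc : ∀ a, P.Mem {v | c v = a}) (a : A) :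
    MeasurableSet[IsProjSigma.ambiguous V P.level] {v | c v = a} := by
  cases P with
  | sigma n =>
    refine ⟨hc a, ?_⟩
    have : {v | c v = a}ᶜ = ⋃ b : {b // b ≠ a}, {v | c v = b} := by
      ext v
      simp
    rw [this]
    exact IsProjSigma.iUnion fun b => hc b
  | pi n =>
    refine ⟨?_, hc a⟩
    have : {v | c v = a} = ⋂ b : {b // b ≠ a}, {v | c v = b}ᶜ := by
      ext v
      simp [imp_not_comm]
    rw [this]
    exact IsProjSigma.iInter fun b => hc b
  | delta n => exact hc a

end LusinPointclass

/-! ### The dichotomy -/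

theorem theorem3p13 (P : LusinPointclass) (V : Type u) [TopologicalSpace V] [PolishSpace V]
    (f : Fin 2 → V → V) (hf : ∀ i, P.IsFunction (f i)) :
    P.chromaticNumber (generatedGraph f) ≤ 5 ∨ ℵ₀ ≤ P.chromaticNumber (generatedGraph f) := by
  refine (lt_or_ge (P.chromaticNumber (generatedGraph f)) ℵ₀).imp_left fun hlt => ?_
  obtain ⟨A, c, hA, hc⟩ := csInf_mem (P.colouringCardinals_nonempty (generatedGraph f))
  have : Finite A := lt_aleph0_iff_finite.1 (hA ▸ hlt)
  obtain ⟨N, ⟨e⟩⟩ := Finite.exists_equiv_fin A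
  let := IsProjSigma.ambiguous V P.level
  obtain ⟨d, hd, hlt, hne⟩ := exists_measurable_five_colouring (V := V)
    (f := fun b => f (bif b then 1 else 0)) (c := fun v => (e (c v) : ℕ)) (N := N)
    (fun b => IsProjSigma.measurable_ambiguous fun U hU => (hf _).ambiguous_preimage hU)
    (measurable_to_countable' fun k => by
      by_cases hk : k < N
      · convert LusinPointclass.ambiguous_fiber hc (e.symm ⟨k, hk⟩) using 1
        ext v
        simp [Equiv.eq_symm_apply, Fin.ext_iff]
      · convert MeasurableSet.empty using 1
        ext v
        have := (e (c v)).2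
        simp only [Set.mem_preimage, Set.mem_singleton_iff, Set.mem_empty_iff_false, iff_false]
        omega)
    (fun v => (e (c v)).2)
    fun b v hv h => c.valid (v := v) (w := f (bif b then 1 else 0) v) ⟨hv.symm, _, .inl rfl⟩
      (e.injective (Fin.ext h.symm))
  have hne' : ∀ (i : Fin 2) v, f i v ≠ v → d (f i v) ≠ d v := by
    intro i
    fin_cases i
    exacts [hne false, hne true]
  refine csInf_le' ⟨ULift (Fin 5), SimpleGraph.Coloring.mk (fun v => ⟨d v, hlt v⟩) ?_, ?_, ?_⟩
  · rintro v w ⟨hvw, i, rfl | rfl⟩ h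
    · exact hne' i v hvw.symm (by simpa using h.symm)
    · exact hne' i w hvw (by simpa using h)
  · simp
  · intro a
    refine .of_ambiguous ?_
    convert hd (measurableSet_singleton (a.down : ℕ)) using 1
    ext v
    simp [SimpleGraph.Coloring.mk, ULift.ext_iff, Fin.ext_iff]
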